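/- Let $K\ge 1$, $\mathcal X=\{1,\dots,K\}$, and let $\mathcal X^*$ be the set of all finite words over $\mathcal X$. Let $\mathcal S\subseteq\mathcal X^*$ be a finite-type constraint, i.e. there is a finite set $\mathcal F\subset\mathcal X^*$ such that $\mathcal S$ consists of all words that contain no element of $\mathcal F$ as a contiguous subword. Assume that $\mathcal S$ contains a non-empty word and is irreducible: for all $u,v\in\mathcal S$ there is $w\in\mathcal S$ with $uwv\in\mathcal S$. Let $E=(E_n)_{n\in\mathbb Z}$ be a stationary ergodic process with values in $\{0,1\}$ and erasure rate $\varepsilon=P(E_1=0)$. For a stationary process $X=(X_n)_{n\in\mathbb Z}$ with values in $\mathcal X$, independent of $E$, let $Y_n=X_nE_n$ be the output of the erasure channel, and let $$I(X;Y)=\lim_{n\to\infty}\frac1n I(X_1,\dots,X_n;Y_1,\dots,Y_n)$$ be the mutual information rate (in nats). Let $$C(\mathcal S,\varepsilon)=\sup_X I(X;Y),$$ where the supremum is over all stationary processes $X$ supported on $\mathcal S$, i.e. such that every finite word occurring in $X$ with positive probability belongs to $\mathcal S$. (The capacity depends on the law of $E$; $C(\mathcal S,0)$ is the capacity for an erasure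 process of erasure rate $0$, i.e. with $E_n=1$ almost surely for all $n$.) Then the limits above exist, the suprema defining $C(\mathcal S,\varepsilon)$ and $C(\mathcal S,0)$ are over non-empty bounded sets, and $$(1-\varepsilon)\,C(\mathcal S,0)\le C(\mathcal S,\varepsilon)\le(1-\varepsilon)\log K .$$ -/

import Mathlib

open MeasureTheory Filter Topology

noncomputable section

namespace ErasureChannel

/-! ### Constraints -/

/-- The input alphabet `{1, …, K}`. -/
abbrev Input (K : ℕ) : Type := Finset.Icc 1 K

/-- The finite-type constraint with forbidden set `F`: all finite words that contain no element
of `F` as a contiguous subword. -/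
def finiteTypeConstraint {α : Type*} (F : Finset (List α)) : Set (List α) :=
  {w | ∀ f ∈ F, ¬ f <:+: w}

def IsFiniteType {α : Type*} (S : Set (List α)) : Prop :=
  ∃ F : Finset (List α), S = finiteTypeConstraint F

def IsIrreducibleConstraint {α : Type*} (S : Set (List α)) : Prop :=
  ∀ u ∈ S, ∀ v ∈ S, ∃ w ∈ S, u ++ w ++ v ∈ S

/-! ### Stationary processes, given by their laws on the two-sided path space -/

/-- The shift on two-sided sequences. -/
def shift {α : Type*} (x : ℤ → α) : ℤ → α := fun n => x (n + 1)

/-- `w` is read off from `x` at the positions `i, i + 1, …, i + |w| - 1`. -/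
def ReadsAt {α : Type*} (x : ℤ → α) (i : ℤ) (w : List α) : Prop :=
  ∀ k : Fin w.length, x (i + (k : ℤ)) = w.get k

/-- The set of all finite words that the process with law `μ` produces with positive
probability. -/
def allowedWords {α : Type*} [MeasurableSpace α] (μ : Measure (ℤ → α)) : Set (List α) :=
  {w | ∃ i : ℤ, 0 < μ {x | ReadsAt x i w}}

/-- `μ` is the law of a stationary process supported on the constraint `S`. -/
structure IsAdmissibleInput {K : ℕ} (S : Set (List (Input K)))
    (μ : Measure (ℤ → Input K)) : Prop where
  prob : IsProbabilityMeasure μ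
  stationary : MeasurePreserving shift μ μ
  supported : allowedWords μ ⊆ S

/-- `ν` is the law of a binary stationary and ergodic process with `P(E₁ = 0) = ε`
(`Ergodic` includes invariance of `ν` under the shift). -/
structure IsErasureProcess (ν : Measure (ℤ → Fin 2)) (ε : ℝ) : Prop where
  prob : IsProbabilityMeasure ν
  ergodic : Ergodic shift ν
  rate : ν.real {e | e 1 = 0} = ε

/-! ### Entropy and mutual information of finite-valued random variables (in nats) -/

def entropy {Ω α : Type*} [MeasurableSpace Ω] [Fintype α] (P : Measure Ω) (Z : Ω → α) : ℝ :=
  ∑ a, Real.negMulLog (P.real (Z ⁻¹' {a}))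

def mutualInfo {Ω α β : Type*} [MeasurableSpace Ω] [Fintype α] [Fintype β]
    (P : Measure Ω) (Z : Ω → α) (W : Ω → β) : ℝ :=
  entropy P Z + entropy P W - entropy P (fun ω => (Z ω, W ω))

/-! ### The channel `Yₙ = Xₙ Eₙ` -/

/-- The product `x · e`, an element of the output alphabet `{0, …, K}`. -/
def erase {K : ℕ} (x : Input K) (e : Fin 2) : Fin (K + 1) :=
  ⟨(x : ℕ) * (e : ℕ), by
    have hx := (Finset.mem_Icc.mp x.2).2
    have he : (e : ℕ) ≤ 1 := by omega
    calc (x : ℕ) * (e : ℕ) ≤ K * 1 := Nat.mul_le_mul hx he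
      _ < K + 1 := by omega⟩

/-- The input block `X₁, …, Xₙ`, on the probability space of pairs (input, erasure). -/
def inputBlock {K : ℕ} (n : ℕ) (ω : (ℤ → Input K) × (ℤ → Fin 2)) : Fin n → Input K :=
  fun k => ω.1 ((k : ℤ) + 1)

/-- The output block `Y₁, …, Yₙ`. -/
def outputBlock {K : ℕ} (n : ℕ) (ω : (ℤ → Input K) × (ℤ → Fin 2)) : Fin n → Fin (K + 1) :=
  fun k => erase (ω.1 ((k : ℤ) + 1)) (ω.2 ((k : ℤ) + 1))

/-- `I(X₁, …, Xₙ; Y₁, …, Yₙ) / n`. The product measure expresses that the input and the erasure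
process are independent. -/
def blockRate {K : ℕ} (μ : Measure (ℤ → Input K)) (ν : Measure (ℤ → Fin 2)) (n : ℕ) : ℝ :=
  mutualInfo (μ.prod ν) (inputBlock n) (outputBlock n) / n

/-- The mutual information rate `I(X;Y) = lim I(X₁, …, Xₙ; Y₁, …, Yₙ) / n`. -/
def mutualInfoRate {K : ℕ} (μ : Measure (ℤ → Input K)) (ν : Measure (ℤ → Fin 2)) : ℝ :=
  limUnder atTop (blockRate μ ν)

/-- The rates achieved by stationary inputs supported on `S`. -/
def achievableRates {K : ℕ} (S : Set (List (Input K))) (ν : Measure (ℤ → Fin 2)) : Set ℝ :=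
  {r | ∃ μ, IsAdmissibleInput S μ ∧ r = mutualInfoRate μ ν}

/-- The capacity of the channel with erasure law `ν` and input constraint `S`. -/
def capacity {K : ℕ} (S : Set (List (Input K))) (ν : Measure (ℤ → Fin 2)) : ℝ :=
  sSup (achievableRates S ν)

/-- The limits and the supremum in the definition of the capacity are genuine: every mutual
information rate exists as a limit, and the set of rates is non-empty and bounded above. -/
structure CapacityWellDefined {K : ℕ} (S : Set (List (Input K)))
    (ν : Measure (ℤ → Fin 2)) : Prop where
  tendsto : ∀ μ, IsAdmissibleInput S μ →
    Tendsto (blockRate μ ν) atTop (𝓝 (mutualInfoRate μ ν))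
  nonempty : (achievableRates S ν).Nonempty
  bddAbove : BddAbove (achievableRates S ν)

end ErasureChannel

end

/-! Input letters are at least 1, so a zero output marks an erasure and the output block reveals the
erasure pattern. As this pattern is independent of the input, I(X₁…Xₙ; Y₁…Yₙ) is the mean of H(X_A),
with A the random set of unerased positions (`mutualInfo_eq_integral`). What remains concerns the
set function A ↦ H(X_A), which is monotone, submodular, translation invariant and at most |A| log K.

Stationarity makes the mean subadditive in n, so the rate exists by Fekete's lemma. The upper bound
follows from E|A| = n(1-ε). For the lower bound, conditioning on fewer letters raises entropy: each
k ∈ A contributes to H(X_A) at least what it contributes to the entropy of the full block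
(`sum_increments_le_positionEntropy`). Averaging gives at least (1-ε) H(X₁…Xₙ), while no erasure
process yields more than H(X₁…Xₙ). Both bounds hold for each input, hence for the suprema.
Admissible inputs exist because an irreducible finite-type constraint carries a periodic sequence
(`exists_periodic_sequence`). -/

noncomputable section

namespace ErasureChannel

/-! ### Entropy of finite-valued random variables -/

section Entropy

open Real (negMulLog log)

/-- Concavity: the right side is the tangent at p = 1/n. Summed over n atoms of total mass 1, the
terms 1/n - p cancel and log n remains. -/
lemma negMulLog_le_tangent {n p : ℝ} (hn : 0 < n) (hp : 0 ≤ p) :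
    negMulLog p ≤ p * log n + 1 / n - p := by
  rcases hp.eq_or_lt with rfl | hp
  · simp only [Real.negMulLog_zero]
    have : 0 < 1 / n := by positivity
    linarith
  · have h := Real.log_le_sub_one_of_pos (show 0 < 1 / (n * p) by positivity)
    rw [one_div, Real.log_inv, Real.log_mul hn.ne' hp.ne'] at h
    have h2 := mul_le_mul_of_nonneg_left h hp.le
    have h3 : p * ((n * p)⁻¹ - 1) = 1 / n - p := by field_simp
    rw [Real.negMulLog]
    linarith

/-- This is log t ≤ t - 1 at t = ab/(pc), multiplied by p. The bounds on a, b, c make them positive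
wherever p is. -/
lemma log_ratio_bound {p a b c : ℝ} (hp : 0 ≤ p) (ha : p ≤ a) (hb : p ≤ b) (hc : p ≤ c) :
    p - a * b / c ≤ p * (log p + log c - log a - log b) := by
  rcases hp.eq_or_lt with rfl | hp
  · have : 0 ≤ a * b / c := by positivity
    linarith
  · have ha' := hp.trans_le ha
    have hb' := hp.trans_le hb
    have hc' := hp.trans_le hc
    have h := Real.log_le_sub_one_of_pos (show 0 < a * b / (p * c) by positivity)
    rw [Real.log_div (by positivity) (by positivity), Real.log_mul ha'.ne' hb'.ne',
      Real.log_mul hp.ne' hc'.ne'] at h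
    have h2 := mul_le_mul_of_nonneg_left h hp.le
    have h3 : p * (a * b / (p * c) - 1) = a * b / c - p := by field_simp
    linarith

/-- Submodularity of the entropy, for a finitely supported weight on triples. -/
lemma sum_negMulLog_submodular {α β γ : Type*} [Fintype α] [Fintype β] [Fintype γ]
    (p : α → β → γ → ℝ) (hp : ∀ a b c, 0 ≤ p a b c) :
    (∑ a, ∑ b, ∑ c, negMulLog (p a b c)) + ∑ c, negMulLog (∑ a, ∑ b, p a b c) ≤
      (∑ a, ∑ c, negMulLog (∑ b, p a b c)) + ∑ b, ∑ c, negMulLog (∑ a, p a b c) := by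
  set f : α → γ → ℝ := fun a c => ∑ b, p a b c with hf
  set g : β → γ → ℝ := fun b c => ∑ a, p a b c with hg
  set r : γ → ℝ := fun c => ∑ a, ∑ b, p a b c with hr
  have hfr : ∀ c, ∑ a, f a c = r c := fun c => rfl
  have hgr : ∀ c, ∑ b, g b c = r c := fun c => Finset.sum_comm
  have hpf : ∀ a b c, p a b c ≤ f a c := fun a b c =>
    Finset.single_le_sum (f := fun b => p a b c) (fun b _ => hp a b c) (Finset.mem_univ b)
  have hpg : ∀ a b c, p a b c ≤ g b c := fun a b c =>
    Finset.single_le_sum (f := fun a => p a b c) (fun a _ => hp a b c) (Finset.mem_univ a)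
  have hfr' : ∀ a c, f a c ≤ r c := fun a c =>
    Finset.single_le_sum (f := fun a => f a c)
      (fun a _ => Finset.sum_nonneg fun b _ => hp a b c) (Finset.mem_univ a)
  -- For each c the weight f·g/r has the same mass as p, also when r c = 0 since then the quotient
  -- is 0. So the termwise lower bounds add up to zero.
  have key : ∀ c, ∑ a, ∑ b, (p a b c - f a c * g b c / r c) = 0 := by
    intro c
    have h1 : ∑ a, ∑ b, f a c * g b c / r c = r c := by
      simp_rw [mul_div_assoc, ← Finset.mul_sum, ← Finset.sum_div, hgr, ← Finset.sum_mul, hfr]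
      rw [← mul_div_assoc, mul_self_div_self]
    simp_rw [Finset.sum_sub_distrib, h1]
    exact sub_self _
  have hmain : 0 ≤ ∑ c, ∑ a, ∑ b,
      p a b c * (log (p a b c) + log (r c) - log (f a c) - log (g b c)) := by
    refine Finset.sum_nonneg fun c _ => ?_
    rw [← key c]
    exact Finset.sum_le_sum fun a _ => Finset.sum_le_sum fun b _ =>
      log_ratio_bound (hp a b c) (hpf a b c) (hpg a b c) ((hpf a b c).trans (hfr' a c))
  have e1 : ∑ a, ∑ b, ∑ c, negMulLog (p a b c)
      = -∑ c, ∑ a, ∑ b, p a b c * log (p a b c) := by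
    simp_rw [Real.negMulLog, neg_mul, Finset.sum_neg_distrib]
    congr 1
    rw [Finset.sum_comm' (t' := Finset.univ) (s' := fun _ => Finset.univ) (by simp)]
    rw [Finset.sum_comm]
    rw [Finset.sum_congr rfl fun a _ => Finset.sum_comm]
    rw [Finset.sum_comm]
  have e2 : ∑ c, negMulLog (r c) = -∑ c, ∑ a, ∑ b, p a b c * log (r c) := by
    simp_rw [Real.negMulLog, neg_mul, Finset.sum_neg_distrib, ← Finset.sum_mul]
    rfl
  have e3 : ∑ a, ∑ c, negMulLog (f a c) = -∑ c, ∑ a, ∑ b, p a b c * log (f a c) := by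
    simp_rw [Real.negMulLog, neg_mul, Finset.sum_neg_distrib, ← Finset.sum_mul]
    rw [Finset.sum_comm]
  have e4 : ∑ b, ∑ c, negMulLog (g b c) = -∑ c, ∑ a, ∑ b, p a b c * log (g b c) := by
    rw [Finset.sum_comm, ← Finset.sum_neg_distrib]
    refine Finset.sum_congr rfl fun c _ => ?_
    rw [Finset.sum_comm]
    simp_rw [Real.negMulLog, neg_mul, Finset.sum_neg_distrib, ← Finset.sum_mul]
    rfl
  simp_rw [mul_sub, mul_add, Finset.sum_sub_distrib, Finset.sum_add_distrib] at hmain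
  rw [e1, e2, e3, e4]
  linarith

lemma exists_of_entropy_term_ne_zero {Ω α : Type*} [MeasurableSpace Ω] {P : Measure Ω} {Z : Ω → α}
    {a : α} (ha : negMulLog (P.real (Z ⁻¹' {a})) ≠ 0) : ∃ ω, Z ω = a := by
  by_contra! hcon
  apply ha
  have : Z ⁻¹' {a} = ∅ := by ext ω; simpa using hcon ω
  simp [this]

variable {Ω α β γ : Type*} [MeasurableSpace Ω] [Fintype α] [Fintype β] [Fintype γ]

/-- The entropy of a random variable depends only on the partition it induces. -/
lemma entropy_congr (P : Measure Ω) {Z : Ω → α} {W : Ω → β}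
    (h : ∀ ω ω', Z ω = Z ω' ↔ W ω = W ω') : entropy P Z = entropy P W := by
  classical
  have hfib : ∀ ω, Z ⁻¹' {Z ω} = W ⁻¹' {W ω} := fun ω => by
    ext ω'; exact h ω' ω
  unfold entropy
  -- Values with a non-zero term are attained; each is matched with the value of `W` at a chosen
  -- preimage.
  refine Finset.sum_bij_ne_zero (fun a _ ha => W (exists_of_entropy_term_ne_zero ha).choose)
    (fun _ _ _ => Finset.mem_univ _) ?_ ?_ ?_
  · intro a _ ha b _ hb hab
    rw [← (exists_of_entropy_term_ne_zero ha).choose_spec,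
      ← (exists_of_entropy_term_ne_zero hb).choose_spec]
    exact (h _ _).2 hab
  · intro b _ hb
    obtain ⟨ω, rfl⟩ := exists_of_entropy_term_ne_zero hb
    have ha : negMulLog (P.real (Z ⁻¹' {Z ω})) ≠ 0 := by rwa [hfib]
    exact ⟨Z ω, Finset.mem_univ _, ha, (h _ _).1 (exists_of_entropy_term_ne_zero ha).choose_spec⟩
  · intro a _ ha
    rw [← hfib, (exists_of_entropy_term_ne_zero ha).choose_spec]

lemma entropy_nonneg (P : Measure Ω) [IsProbabilityMeasure P] (Z : Ω → α) : 0 ≤ entropy P Z :=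
  Finset.sum_nonneg fun _ _ => Real.negMulLog_nonneg measureReal_nonneg measureReal_le_one

lemma entropy_of_subsingleton (P : Measure Ω) [IsProbabilityMeasure P] [Subsingleton α]
    (Z : Ω → α) : entropy P Z = 0 := by
  refine Finset.sum_eq_zero fun a _ => ?_
  have : Z ⁻¹' {a} = Set.univ := by ext ω; simp [Subsingleton.elim (Z ω) a]
  simp [this]

variable [MeasurableSpace α] [MeasurableSingletonClass α] [MeasurableSpace β]
  [MeasurableSingletonClass β] [MeasurableSpace γ] [MeasurableSingletonClass γ]

lemma measureReal_eq_sum_fiber (P : Measure Ω) [IsFiniteMeasure P] {B : Ω → β}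
    (hB : Measurable B) {s : Set Ω} (hs : MeasurableSet s) :
    P.real s = ∑ b, P.real (s ∩ B ⁻¹' {b}) := by
  rw [← measureReal_biUnion_finset]
  · congr 1; ext ω; simp
  · intro b _ b' _ hbb'
    refine Set.disjoint_left.2 fun ω h1 h2 => hbb' ?_
    exact h1.2.symm.trans h2.2
  · exact fun b _ => hs.inter (hB (measurableSet_singleton b))

lemma sum_measureReal_fiber (P : Measure Ω) [IsProbabilityMeasure P] {B : Ω → β}
    (hB : Measurable B) : ∑ b, P.real (B ⁻¹' {b}) = 1 := by
  simpa using (measureReal_eq_sum_fiber P hB MeasurableSet.univ).symm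

lemma entropy_le_log_card (P : Measure Ω) [IsProbabilityMeasure P] [Nonempty α] {Z : Ω → α}
    (hZ : Measurable Z) : entropy P Z ≤ log (Fintype.card α) := by
  have hn : (0 : ℝ) < Fintype.card α := by exact_mod_cast Fintype.card_pos
  calc entropy P Z ≤ ∑ a, (P.real (Z ⁻¹' {a}) * log (Fintype.card α) + 1 / Fintype.card α
        - P.real (Z ⁻¹' {a})) :=
        Finset.sum_le_sum fun a _ => negMulLog_le_tangent hn measureReal_nonneg
    _ = log (Fintype.card α) := by
        rw [Finset.sum_sub_distrib, Finset.sum_add_distrib, ← Finset.sum_mul,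
          sum_measureReal_fiber P hZ]
        simp [hn.ne']

/-- Non-negativity of the conditional mutual information I(A;B|C), free of conditional entropies. It
yields both submodularity and monotonicity of `positionEntropy`. -/
lemma entropy_submodular (P : Measure Ω) [IsProbabilityMeasure P] {A : Ω → α} {B : Ω → β}
    {C : Ω → γ} (hA : Measurable A) (hB : Measurable B) (hC : Measurable C) :
    entropy P (fun ω => (A ω, B ω, C ω)) + entropy P C ≤
      entropy P (fun ω => (A ω, C ω)) + entropy P (fun ω => (B ω, C ω)) := by
  have mA := fun a => hA (measurableSet_singleton a)
  have mB := fun a => hB (measurableSet_singleton a)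
  have mC := fun a => hC (measurableSet_singleton a)
  have h := sum_negMulLog_submodular
    (fun a b c => P.real (A ⁻¹' {a} ∩ B ⁻¹' {b} ∩ C ⁻¹' {c})) fun _ _ _ => measureReal_nonneg
  have h1 : ∀ a c, ∑ b, P.real (A ⁻¹' {a} ∩ B ⁻¹' {b} ∩ C ⁻¹' {c})
      = P.real (A ⁻¹' {a} ∩ C ⁻¹' {c}) := fun a c => by
    rw [measureReal_eq_sum_fiber P hB ((mA a).inter (mC c))]
    exact Finset.sum_congr rfl fun b _ => by rw [Set.inter_right_comm]
  have h2 : ∀ b c, ∑ a, P.real (A ⁻¹' {a} ∩ B ⁻¹' {b} ∩ C ⁻¹' {c})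
      = P.real (B ⁻¹' {b} ∩ C ⁻¹' {c}) := fun b c => by
    rw [measureReal_eq_sum_fiber P hA ((mB b).inter (mC c))]
    exact Finset.sum_congr rfl fun a _ => by rw [Set.inter_assoc, Set.inter_comm]
  have h3 : ∀ c, ∑ a, P.real (A ⁻¹' {a} ∩ C ⁻¹' {c}) = P.real (C ⁻¹' {c}) := fun c => by
    rw [measureReal_eq_sum_fiber P hA (mC c)]
    exact Finset.sum_congr rfl fun a _ => by rw [Set.inter_comm]
  simp only [h1, h2, h3] at h
  simp only [entropy, Fintype.sum_prod_type]
  convert h using 8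
  · ext ω; simp [and_assoc]
  all_goals ext ω; simp

end Entropy

/-! ### Mutual information over the channel -/

section Channel

open Real (negMulLog log)

lemma integral_comp_of_fintype {Ω β : Type*} [MeasurableSpace Ω] [Fintype β] [MeasurableSpace β]
    [MeasurableSingletonClass β] (P : Measure Ω) [IsProbabilityMeasure P] {g : Ω → β}
    (hg : Measurable g) (F : β → ℝ) : ∫ ω, F (g ω) ∂P = ∑ b, P.real (g ⁻¹' {b}) * F b := by
  have := Measure.isProbabilityMeasure_map (μ := P) hg.aemeasurable
  rw [← integral_map hg.aemeasurable (measurable_of_finite F).aestronglyMeasurable,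
    integral_fintype Integrable.of_finite]
  refine Finset.sum_congr rfl fun b _ => ?_
  rw [map_measureReal_apply hg (measurableSet_singleton b), smul_eq_mul]

/-- Chain rule: the joint entropy of `Z` and of a random variable that, given `Z = b`, is a
function `f · b` of an independent random element. -/
lemma entropy_prod_chain {Ω₁ Ω₂ α β : Type*} [MeasurableSpace Ω₁] [MeasurableSpace Ω₂]
    [Fintype α] [Fintype β] [MeasurableSpace α] [MeasurableSingletonClass α]
    (μ : Measure Ω₁) (ν : Measure Ω₂) [IsProbabilityMeasure μ] [IsProbabilityMeasure ν]
    (f : Ω₁ → β → α) (hf : ∀ b, Measurable fun x => f x b) (Z : Ω₂ → β) :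
    entropy (μ.prod ν) (fun ω => (f ω.1 (Z ω.2), Z ω.2)) =
      entropy ν Z + ∑ b, ν.real (Z ⁻¹' {b}) * entropy μ (fun x => f x b) := by
  have hpre : ∀ a b, (fun ω : Ω₁ × Ω₂ => (f ω.1 (Z ω.2), Z ω.2)) ⁻¹' {(a, b)} =
      ((fun x => f x b) ⁻¹' {a}) ×ˢ (Z ⁻¹' {b}) := by
    intro a b
    ext ω
    simp only [Set.mem_preimage, Set.mem_singleton_iff, Prod.mk.injEq, Set.mem_prod]
    constructor
    · rintro ⟨h, rfl⟩; exact ⟨h, rfl⟩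
    · rintro ⟨h, rfl⟩; exact ⟨h, rfl⟩
  unfold entropy
  rw [Fintype.sum_prod_type, Finset.sum_comm, ← Finset.sum_add_distrib]
  refine Finset.sum_congr rfl fun b _ => ?_
  simp only [hpre, measureReal_prod_prod, Real.negMulLog_mul]
  rw [Finset.sum_add_distrib, ← Finset.mul_sum, ← Finset.sum_mul, sum_measureReal_fiber μ (hf b)]
  ring

lemma entropy_prod_fst {Ω₁ Ω₂ α : Type*} [MeasurableSpace Ω₁] [MeasurableSpace Ω₂]
    [Fintype α] (μ : Measure Ω₁) (ν : Measure Ω₂) [IsProbabilityMeasure μ]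
    [IsProbabilityMeasure ν] (f : Ω₁ → α) :
    entropy (μ.prod ν) (fun ω => f ω.1) = entropy μ f := by
  unfold entropy
  refine Finset.sum_congr rfl fun a _ => ?_
  have : (fun ω : Ω₁ × Ω₂ => f ω.1) ⁻¹' {a} = (f ⁻¹' {a}) ×ˢ Set.univ := by ext; simp
  rw [this, measureReal_prod_prod]
  simp

variable {K : ℕ}

lemma erase_one_injective {x y : Input K} (h : erase x 1 = erase y 1) : x = y := by
  have := congrArg Fin.val h
  simp only [erase, Fin.val_one, mul_one] at this
  exact Subtype.ext this

lemma erase_zero (x : Input K) : erase x 0 = 0 := by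
  apply Fin.ext
  simp [erase]

lemma erase_one_ne_zero (x : Input K) : erase x 1 ≠ 0 := by
  intro h
  have := congrArg Fin.val h
  have hx := (Finset.mem_Icc.mp x.2).1
  simp only [erase, Fin.val_one, mul_one, Fin.val_zero] at this
  omega

lemma eq_of_erase_eq_erase {x y : Input K} {d e : Fin 2} (h : erase x d = erase y e) : d = e := by
  fin_cases d <;> fin_cases e
  · rfl
  · exact absurd (h.symm.trans (erase_zero x)) (erase_one_ne_zero y)
  · exact absurd (h.trans (erase_zero y)) (erase_one_ne_zero x)
  · rfl

lemma erase_eq_erase_iff {x y : Input K} {e : Fin 2} :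
    erase x e = erase y e ↔ (e = 1 → x = y) := by
  fin_cases e
  · simp [erase_zero]
  · simpa using ⟨fun h => erase_one_injective h, fun h => by rw [h]⟩

/-- The entropy of the letters of the process `μ` at the positions `k + 1`, `k ∈ A`. -/
def positionEntropy (μ : Measure (ℤ → Input K)) (A : Finset ℕ) : ℝ :=
  entropy μ (fun x (k : A) => x ((k : ℕ) + 1))

/-- The `k < n` such that the letter at the position `k + 1` is not erased. -/
def unerased (n : ℕ) (e : ℤ → Fin 2) : Finset ℕ :=
  (Finset.range n).filter fun k => e (k + 1) = 1

/-- The first `n` letters of a two-sided sequence. -/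
def block {α : Type*} (n : ℕ) (x : ℤ → α) : Fin n → α := fun k => x ((k : ℤ) + 1)

lemma measurable_block {α : Type*} [MeasurableSpace α] (n : ℕ) :
    Measurable (block n : (ℤ → α) → _) :=
  measurable_pi_lambda _ fun _ => measurable_pi_apply _

lemma unerased_eq_of_block_eq {n : ℕ} {e e' : ℤ → Fin 2} (h : block n e = block n e') :
    unerased n e = unerased n e' := by
  refine Finset.filter_congr fun k hk => ?_
  have := congrFun h ⟨k, Finset.mem_range.1 hk⟩
  simp only [block] at this
  rw [this]

/-- Reduction to a function on a finite type, from which measurability and integrability are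
immediate. -/
lemma exists_comp_block (n : ℕ) (G : Finset ℕ → ℝ) :
    ∃ F : (Fin n → Fin 2) → ℝ, ∀ e, G (unerased n e) = F (block n e) := by
  have h : Function.FactorsThrough (fun e => G (unerased n e)) (block n) :=
    fun _ _ h => congrArg G (unerased_eq_of_block_eq h)
  exact ⟨Function.extend (block n) _ 0, fun e => (h.extend_apply 0 e).symm⟩

lemma measurable_comp_unerased (n : ℕ) (G : Finset ℕ → ℝ) :
    Measurable fun e => G (unerased n e) := by
  obtain ⟨F, hF⟩ := exists_comp_block n G
  simp_rw [hF]
  exact (measurable_of_finite F).comp (measurable_block n)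

lemma integrable_comp_unerased (ν : Measure (ℤ → Fin 2)) [IsProbabilityMeasure ν] (n : ℕ)
    (G : Finset ℕ → ℝ) : Integrable (fun e => G (unerased n e)) ν := by
  obtain ⟨F, hF⟩ := exists_comp_block n G
  simp_rw [hF]
  have := Measure.isProbabilityMeasure_map (μ := ν) (measurable_block n).aemeasurable
  exact (Integrable.of_finite (f := F)).comp_measurable (measurable_block n)

/-- The mutual information over the channel is the mean entropy of the letters that are not
erased. -/
lemma mutualInfo_eq_integral (μ : Measure (ℤ → Input K)) (ν : Measure (ℤ → Fin 2))
    [IsProbabilityMeasure μ] [IsProbabilityMeasure ν] (n : ℕ) :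
    mutualInfo (μ.prod ν) (inputBlock n) (outputBlock n) =
      ∫ e, positionEntropy μ (unerased n e) ∂ν := by
  have hX : entropy (μ.prod ν) (inputBlock n) = entropy μ (block n) :=
    entropy_prod_fst μ ν (block n)
  have hXY : entropy (μ.prod ν) (fun ω => (inputBlock n ω, outputBlock n ω)) =
      entropy (μ.prod ν) (fun ω => (block n ω.1, block n ω.2)) := by
    refine entropy_congr _ fun ω ω' => ?_
    simp only [Prod.mk.injEq]
    refine and_congr_right fun h => ⟨fun h' => ?_, fun h' => ?_⟩
    · exact funext fun k => eq_of_erase_eq_erase (congrFun h' k)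
    · exact funext fun k => congrArg₂ erase (congrFun h k) (congrFun h' k)
  have hY : entropy (μ.prod ν) (outputBlock n) = entropy (μ.prod ν)
      (fun ω => ((fun k => erase (block n ω.1 k) (block n ω.2 k)), block n ω.2)) := by
    refine entropy_congr _ fun ω ω' => ?_
    simp only [Prod.mk.injEq]
    exact ⟨fun h => ⟨h, funext fun k => eq_of_erase_eq_erase (congrFun h k)⟩, fun h => h.1⟩
  have hmeas : ∀ b : Fin n → Fin 2,
      Measurable fun x : ℤ → Input K => fun k => erase (block n x k) (b k) := fun b =>
    measurable_pi_lambda _ fun k => (measurable_of_finite fun a => erase a (b k)).comp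
      (measurable_pi_apply ((k : ℤ) + 1))
  -- Both chain rules condition on the erasure block, so H(E) and H(X) cancel in H(X) + H(Y) -
  -- H(X,Y).
  rw [entropy_prod_chain μ ν (fun x b k => erase (block n x k) (b k)) hmeas (block n)] at hY
  rw [entropy_prod_chain μ ν (fun x _ => block n x) (fun _ => measurable_block n) (block n),
    ← Finset.sum_mul, sum_measureReal_fiber ν (measurable_block n), one_mul] at hXY
  have hG : ∀ e, positionEntropy μ (unerased n e) =
      entropy μ (fun x k => erase (block n x k) (block n e k)) := by
    refine fun e => entropy_congr _ fun x x' => ?_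
    simp only [funext_iff, erase_eq_erase_iff, Subtype.forall, unerased, Finset.mem_filter,
      Finset.mem_range, Fin.forall_iff, block, and_imp]
  simp_rw [hG]
  rw [integral_comp_of_fintype ν (measurable_block n)
    (fun b => entropy μ (fun x k => erase (block n x k) (b k)))]
  rw [mutualInfo, hX, hXY, hY]
  ring

/-! ### The entropy of subblocks as a set function -/

lemma measurable_positions (A : Finset ℕ) :
    Measurable (fun (x : ℤ → Input K) (k : A) => x ((k : ℕ) + 1)) :=
  measurable_pi_lambda _ fun _ => measurable_pi_apply _

lemma shift_iterate {α : Type*} (m : ℕ) (x : ℤ → α) (i : ℤ) : shift^[m] x i = x (i + m) := by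
  induction m generalizing x with
  | zero => simp
  | succ m ih =>
    rw [Function.iterate_succ_apply, ih, shift]
    congr 1
    push_cast
    ring

lemma positionEntropy_map_add {μ : Measure (ℤ → Input K)} (hμ : MeasurePreserving shift μ μ)
    (A : Finset ℕ) (m : ℕ) :
    positionEntropy μ (A.map (addRightEmbedding m)) = positionEntropy μ A := by
  have h1 : positionEntropy μ (A.map (addRightEmbedding m)) =
      entropy μ ((fun x (k : A) => x ((k : ℕ) + 1)) ∘ shift^[m]) := by
    refine entropy_congr _ fun x x' => ?_
    simp only [funext_iff, Function.comp_apply, shift_iterate, Subtype.forall, Finset.mem_map,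
      addRightEmbedding_apply, forall_exists_index, and_imp, forall_apply_eq_imp_iff₂]
    refine forall₂_congr fun k _ => ?_
    have : ((k + m : ℕ) : ℤ) + 1 = k + 1 + m := by push_cast; ring
    rw [this]
  rw [h1]
  refine Finset.sum_congr rfl fun a _ => ?_
  rw [Set.preimage_comp, (hμ.iterate m).measureReal_preimage
    (measurable_positions A (measurableSet_singleton a)).nullMeasurableSet]

variable (μ : Measure (ℤ → Input K)) [IsProbabilityMeasure μ]

lemma positionEntropy_nonneg (A : Finset ℕ) : 0 ≤ positionEntropy μ A := entropy_nonneg μ _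

lemma positionEntropy_empty : positionEntropy μ ∅ = 0 := entropy_of_subsingleton μ _

lemma positionEntropy_le (hK : 1 ≤ K) (A : Finset ℕ) :
    positionEntropy μ A ≤ A.card * log K := by
  have : Nonempty (Input K) := ⟨⟨1, Finset.mem_Icc.2 ⟨le_rfl, hK⟩⟩⟩
  refine (entropy_le_log_card μ (measurable_positions A)).trans_eq ?_
  simp

/-- `entropy_submodular` conditioned on the letters in A ∩ B; the triple then carries the same
information as the letters in A ∪ B. -/
lemma positionEntropy_union_add_inter_le (A B : Finset ℕ) :
    positionEntropy μ (A ∪ B) + positionEntropy μ (A ∩ B) ≤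
      positionEntropy μ A + positionEntropy μ B := by
  have h := entropy_submodular μ (measurable_positions A) (measurable_positions B)
    (measurable_positions (A ∩ B))
  refine le_of_eq_of_le ?_ (h.trans_eq ?_)
  · congr 1
    refine entropy_congr _ fun x x' => ?_
    simp only [Prod.mk.injEq, funext_iff, Subtype.forall, Finset.mem_union, Finset.mem_inter]
    grind
  · congr 1 <;> refine entropy_congr _ fun x x' => ?_ <;>
    · simp only [Prod.mk.injEq, funext_iff, Subtype.forall, Finset.mem_inter]
      grind

/-- With both first variables equal to the letters in B, submodularity reads H(B) + H(A) ≤ 2 H(B).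
-/
lemma positionEntropy_mono {A B : Finset ℕ} (hAB : A ⊆ B) :
    positionEntropy μ A ≤ positionEntropy μ B := by
  have h := entropy_submodular μ (measurable_positions B) (measurable_positions B)
    (measurable_positions A)
  have h1 : entropy μ (fun x => ((fun k : B => x ((k : ℕ) + 1)), (fun k : B => x ((k : ℕ) + 1)),
      (fun k : A => x ((k : ℕ) + 1)))) = positionEntropy μ B := by
    refine entropy_congr _ fun x x' => ?_
    simp only [Prod.mk.injEq, funext_iff, Subtype.forall]
    grind
  have h2 : entropy μ (fun x => ((fun k : B => x ((k : ℕ) + 1)),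
      (fun k : A => x ((k : ℕ) + 1)))) = positionEntropy μ B := by
    refine entropy_congr _ fun x x' => ?_
    simp only [Prod.mk.injEq, funext_iff, Subtype.forall]
    grind
  rw [h1, h2] at h
  change _ + positionEntropy μ A ≤ _ at h
  linarith

end Channel

/-! ### Existence of an admissible input -/

section Existence

lemma IsIrreducibleConstraint.exists_length_ge {α : Type*} {S : Set (List α)}
    (hirr : IsIrreducibleConstraint S) (hne : ∃ w ∈ S, w ≠ []) (n : ℕ) :
    ∃ u ∈ S, n ≤ u.length := by
  obtain ⟨v, hv, hv0⟩ := hne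
  induction n with
  | zero => exact ⟨v, hv, Nat.zero_le _⟩
  | succ n ih =>
    obtain ⟨u, hu, hn⟩ := ih
    obtain ⟨w, -, hw⟩ := hirr u hu v hv
    have := List.length_pos_iff.2 hv0
    exact ⟨_, hw, by simp only [List.length_append]; omega⟩

lemma readsAt_iff {α : Type*} {x : ℤ → α} {i : ℤ} {w : List α} :
    ReadsAt x i w ↔ ∀ (k : ℕ) (hk : k < w.length), x (i + k) = w[k] :=
  ⟨fun h k hk => h ⟨k, hk⟩, fun h k => h k k.2⟩

/-- An irreducible finite-type constraint contains all words of some periodic sequence. -/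
lemma exists_periodic_sequence {α : Type*} {S : Set (List α)} (hS : IsFiniteType S)
    (hirr : IsIrreducibleConstraint S) (hne : ∃ w ∈ S, w ≠ []) :
    ∃ (p : ℕ) (x : ℤ → α), 0 < p ∧ (∀ i, x (i + p) = x i) ∧
      ∀ i w, ReadsAt x i w → w ∈ S := by
  obtain ⟨F, rfl⟩ := hS
  -- `u` is longer than every forbidden word; the `+ 1` also makes it non-empty, so the period below
  -- is positive.
  obtain ⟨u, hu, hL⟩ := hirr.exists_length_ge hne (F.sup List.length + 1)
  obtain ⟨w, -, hw⟩ := hirr u hu u hu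
  -- Beginning and ending with `u`, the word `v` has period p and length p + |u|. Every window of
  -- length at most |u| in its periodic extension therefore already occurs in `v`.
  set v := u ++ w ++ u with hv
  set p := u.length + w.length with hp
  have hp0 : 0 < p := by omega
  have hvl : v.length = p + u.length := by simp [hv, hp, add_assoc]
  have hlt : ∀ i : ℤ, (i % p).toNat < v.length := fun i => by
    have h1 := Int.emod_lt_of_pos i (show (0 : ℤ) < p by omega)
    omega
  have hper : ∀ (m : ℕ) (hm : m < u.length), v[m + p]'(by omega) = v[m]'(by omega) := by
    intro m hm
    simp only [hv]
    rw [List.getElem_append_right (by simp; omega), List.getElem_append_left (by simp; omega),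
      List.getElem_append_left hm]
    congr 1
    simp; omega
  refine ⟨p, fun i => v[(i % p).toNat]'(hlt i), hp0, fun i => by simp, fun i z hz f hf => ?_⟩
  rintro ⟨s, t, rfl⟩
  have hfL : f.length ≤ u.length := by
    have : f.length ≤ F.sup List.length := Finset.le_sup (f := List.length) hf
    omega
  rw [readsAt_iff] at hz
  set j := ((i + s.length) % p).toNat with hj
  have hj0 := Int.emod_nonneg (i + s.length) (show (p : ℤ) ≠ 0 by omega)
  have hjp : j < p := by
    have h1 := Int.emod_lt_of_pos (i + s.length) (show (0 : ℤ) < p by omega)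
    omega
  have hread : ∀ (k : ℕ) (hk : k < f.length), v[j + k]'(by omega) = f[k] := by
    intro k hk
    have h1 := hz (s.length + k) (by simp; omega)
    have h0 : (s ++ f ++ t)[s.length + k]'(by simp; omega) = f[k] := by
      rw [List.getElem_append_left (by simp; omega), List.getElem_append_right (by omega)]
      simp only [Nat.add_sub_cancel_left]
    rw [← h0, ← h1]
    have h2 : (i + ((s.length + k : ℕ) : ℤ)) % p = ((j + k : ℕ) : ℤ) % p := by
      push_cast
      rw [hj, Int.toNat_of_nonneg hj0, Int.emod_add_emod, add_assoc]
    simp only [h2]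
    -- Past the end of the first period the index wraps around, and `hper` identifies the letters.
    by_cases hc : j + k < p
    · congr 1
      rw [Int.emod_eq_of_lt (by omega) (by omega), Int.toNat_natCast]
    · have h3 : ((j + k : ℕ) : ℤ) % p = ((j + k - p : ℕ) : ℤ) := by
        rw [← Int.emod_eq_of_lt (a := ((j + k - p : ℕ) : ℤ)) (b := p) (by omega) (by omega)]
        rw [Nat.cast_sub (by omega)]
        simp
      simp only [h3, Int.toNat_natCast]
      rw [← hper (j + k - p) (by omega)]
      congr 1
      omega
  refine hw f hf ⟨v.take j, v.drop (j + f.length), ?_⟩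
  have hmid : f = (v.drop j).take f.length := by
    refine List.ext_getElem (by simp; omega) fun k h1 h2 => ?_
    simp [← hread k h1]
  conv_lhs => rw [hmid]
  simp only [List.length_take, List.length_drop]
  rw [min_eq_left (by omega), List.append_assoc, ← List.drop_drop, List.take_append_drop,
    List.take_append_drop]

lemma measurable_shift {α : Type*} [MeasurableSpace α] : Measurable (shift : (ℤ → α) → ℤ → α) :=
  measurable_pi_lambda _ fun _ => measurable_pi_apply _

lemma measurableSet_readsAt {α : Type*} [MeasurableSpace α] [MeasurableSingletonClass α]
    (i : ℤ) (w : List α) : MeasurableSet {x : ℤ → α | ReadsAt x i w} := by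
  simp only [ReadsAt, Set.ofPred_forall]
  exact MeasurableSet.iInter fun k => measurable_pi_apply _ (measurableSet_singleton _)

/-- The uniform distribution on the shifts of a periodic sequence. -/
def periodicLaw {α : Type*} [MeasurableSpace α] (p : ℕ) (x : ℤ → α) : Measure (ℤ → α) :=
  (p : ENNReal)⁻¹ • ∑ i ∈ Finset.range p, Measure.dirac (shift^[i] x)

lemma isProbabilityMeasure_periodicLaw {α : Type*} [MeasurableSpace α] {p : ℕ} (hp : 0 < p)
    (x : ℤ → α) : IsProbabilityMeasure (periodicLaw p x) := by
  refine ⟨?_⟩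
  simp only [periodicLaw, Measure.smul_apply, Measure.finsetSum_apply, measure_univ,
    Finset.sum_const, Finset.card_range, smul_eq_mul, nsmul_eq_mul, mul_one]
  exact ENNReal.inv_mul_cancel (by simpa using hp.ne') (by simp)

lemma measurePreserving_shift_periodicLaw {α : Type*} [MeasurableSpace α] {p : ℕ} {x : ℤ → α}
    (hx : ∀ i, x (i + p) = x i) : MeasurePreserving shift (periodicLaw p x) (periodicLaw p x) := by
  refine ⟨measurable_shift, ?_⟩
  have hxp : shift^[p] x = x := funext fun i => (shift_iterate p x i).trans (hx i)
  -- The shift permutes the point masses cyclically, as `shift^[p] x = x`.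
  have hsum : ∑ i ∈ Finset.range p, Measure.dirac (shift^[i + 1] x) =
      ∑ i ∈ Finset.range p, Measure.dirac (shift^[i] x) := by
    cases p with
    | zero => simp only [Finset.range_zero, Finset.sum_empty]
    | succ p =>
      rw [Finset.sum_range_succ, hxp, Finset.sum_range_succ' _ p, Function.iterate_zero_apply]
  rw [periodicLaw, Measure.map_smul, ← Measure.mapₗ_apply_of_measurable measurable_shift, map_sum]
  simp only [Measure.mapₗ_apply_of_measurable measurable_shift,
    Measure.map_dirac' measurable_shift, ← Function.iterate_succ_apply' shift]
  rw [hsum]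

lemma exists_isAdmissibleInput {K : ℕ} {S : Set (List (Input K))} (hS : IsFiniteType S)
    (hirr : IsIrreducibleConstraint S) (hne : ∃ w ∈ S, w ≠ []) :
    ∃ μ, IsAdmissibleInput S μ := by
  obtain ⟨p, x, hp, hx, hxS⟩ := exists_periodic_sequence hS hirr hne
  refine ⟨periodicLaw p x, isProbabilityMeasure_periodicLaw hp x,
    measurePreserving_shift_periodicLaw hx, ?_⟩
  rintro w ⟨i, hi⟩
  by_contra hw
  refine hi.ne' ?_
  simp only [periodicLaw, Measure.smul_apply, Measure.finsetSum_apply,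
    Measure.dirac_apply' _ (measurableSet_readsAt i w), smul_eq_mul]
  refine mul_eq_zero_of_right _ (Finset.sum_eq_zero fun k _ => Set.indicator_of_notMem ?_ _)
  intro hk
  refine hw (hxS (i + k) w fun l => ?_)
  rw [← hk l, shift_iterate]
  congr 1
  ring

end Existence

/-! ### Bounds on the mutual information rate -/

section Bounds

variable {K : ℕ}

lemma unerased_succ (n : ℕ) (e : ℤ → Fin 2) :
    unerased (n + 1) e = if e (n + 1) = 1 then insert n (unerased n e) else unerased n e := by
  rw [unerased, Finset.range_add_one, Finset.filter_insert]
  rfl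

lemma card_unerased (n : ℕ) (e : ℤ → Fin 2) :
    ((unerased n e).card : ℝ) = ∑ k ∈ Finset.range n, if e (k + 1) = 1 then (1 : ℝ) else 0 := by
  simp [unerased]

/-- Serves subadditivity; with monotonicity of the entropy, inclusion suffices. -/
lemma unerased_add_subset (m n : ℕ) (e : ℤ → Fin 2) :
    unerased (m + n) e ⊆
      unerased m e ∪ (unerased n (shift^[m] e)).map (addRightEmbedding m) := by
  intro k hk
  simp only [unerased, Finset.mem_filter, Finset.mem_range, Finset.mem_union, Finset.mem_map,
    shift_iterate, addRightEmbedding_apply] at hk ⊢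
  by_cases h : k < m
  · exact Or.inl ⟨h, hk.2⟩
  · refine Or.inr ⟨k - m, ⟨by omega, ?_⟩, by omega⟩
    rw [← hk.2]
    congr 1
    omega

/-- The increments of the entropy over the unerased positions dominate those over all
positions, since conditioning reduces entropy. -/
lemma sum_increments_le_positionEntropy (μ : Measure (ℤ → Input K)) [IsProbabilityMeasure μ]
    (n : ℕ) (e : ℤ → Fin 2) :
    ∑ k ∈ Finset.range n, (if e (k + 1) = 1 then (1 : ℝ) else 0) *
        (positionEntropy μ (Finset.range (k + 1)) - positionEntropy μ (Finset.range k)) ≤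
      positionEntropy μ (unerased n e) := by
  induction n with
  | zero => exact positionEntropy_nonneg μ _
  | succ n ih =>
    rw [Finset.sum_range_succ, unerased_succ]
    split_ifs with h
    · have hsub : unerased n e ⊆ Finset.range n := Finset.filter_subset _ _
      -- The union is the full range up to n and the intersection is the old unerased set, so this
      -- compares the two increments from adding n.
      have h1 := positionEntropy_union_add_inter_le μ (insert n (unerased n e)) (Finset.range n)
      have h2 : insert n (unerased n e) ∪ Finset.range n = Finset.range (n + 1) := by
        rw [Finset.insert_union, Finset.union_eq_right.2 hsub, Finset.range_add_one]
      have h3 : insert n (unerased n e) ∩ Finset.range n = unerased n e := by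
        rw [Finset.insert_inter_of_notMem (by simp), Finset.inter_eq_left.2 hsub]
      rw [h2, h3] at h1
      linarith
    · linarith

variable {ν : Measure (ℤ → Fin 2)} {ε : ℝ}

lemma integrable_indicator_one (ν : Measure (ℤ → Fin 2)) [IsProbabilityMeasure ν] (k : ℤ) :
    Integrable (fun e : ℤ → Fin 2 => if e k = 1 then (1 : ℝ) else 0) ν := by
  have hm : Measurable (fun e : ℤ → Fin 2 => if e k = 1 then (1 : ℝ) else 0) :=
    (measurable_of_finite fun b : Fin 2 => if b = 1 then (1 : ℝ) else 0).comp
      (measurable_pi_apply k)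
  refine Integrable.of_bound hm.aestronglyMeasurable 1 (ae_of_all _ fun e => ?_)
  split_ifs <;> simp

lemma IsErasureProcess.integral_indicator (hν : IsErasureProcess ν ε) (k : ℕ) :
    ∫ e, (if e (k + 1) = 1 then (1 : ℝ) else 0) ∂ν = 1 - ε := by
  have := hν.prob
  have hm0 : MeasurableSet {e : ℤ → Fin 2 | e 1 = 0} :=
    measurable_pi_apply 1 (measurableSet_singleton 0)
  have hk : ν.real {e | e (k + 1) = 0} = ε := by
    rw [← hν.rate, ← (hν.ergodic.toMeasurePreserving.iterate k).measureReal_preimage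
      hm0.nullMeasurableSet]
    congr 1
    ext e
    simp [shift_iterate, add_comm]
  rw [integral_comp_of_fintype ν (measurable_pi_apply ((k : ℤ) + 1))
    (fun b : Fin 2 => if b = 1 then (1 : ℝ) else 0)]
  have hs := sum_measureReal_fiber ν (measurable_pi_apply (X := fun _ : ℤ => Fin 2) ((k : ℤ) + 1))
  rw [Fin.sum_univ_two] at hs ⊢
  have h0 : ν.real ((fun e : ℤ → Fin 2 => e ((k : ℤ) + 1)) ⁻¹' {0}) = ε := hk
  simp only [zero_ne_one, if_false, if_true, mul_zero, mul_one, zero_add]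
  linarith

variable {μ : Measure (ℤ → Input K)}

lemma blockRate_eq [IsProbabilityMeasure μ] [IsProbabilityMeasure ν] (n : ℕ) :
    blockRate μ ν n = (∫ e, positionEntropy μ (unerased n e) ∂ν) / n := by
  rw [blockRate, mutualInfo_eq_integral]

/-- Stationarity enters twice: that of μ moves the second block of letters back to the origin, that
of ν moves its erasure pattern. -/
lemma subadditive_integral_positionEntropy [IsProbabilityMeasure μ] [IsProbabilityMeasure ν]
    (hμ : MeasurePreserving shift μ μ) (hν : MeasurePreserving shift ν ν) :
    Subadditive fun n => ∫ e, positionEntropy μ (unerased n e) ∂ν := by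
  intro m n
  have hintegrable := fun n => integrable_comp_unerased ν n (positionEntropy μ)
  have hshift : ∫ e, positionEntropy μ (unerased n (shift^[m] e)) ∂ν =
      ∫ e, positionEntropy μ (unerased n e) ∂ν := by
    have h := integral_map (hν.iterate m).measurable.aemeasurable
      (measurable_comp_unerased n (positionEntropy μ)).aestronglyMeasurable (μ := ν)
    rw [(hν.iterate m).map_eq] at h
    exact h.symm
  have hintegrable_shift : Integrable (fun e => positionEntropy μ (unerased n (shift^[m] e))) ν :=
    (hν.iterate m).integrable_comp_of_integrable (hintegrable n)
  dsimp only
  rw [← hshift, ← integral_add (hintegrable m) hintegrable_shift]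
  refine integral_mono (hintegrable _) ((hintegrable m).add hintegrable_shift) fun e => ?_
  have h1 := positionEntropy_mono μ (unerased_add_subset m n e)
  have h2 := positionEntropy_union_add_inter_le μ (unerased m e)
    ((unerased n (shift^[m] e)).map (addRightEmbedding m))
  have h3 := positionEntropy_nonneg μ
    (unerased m e ∩ (unerased n (shift^[m] e)).map (addRightEmbedding m))
  rw [positionEntropy_map_add hμ] at h2
  exact h1.trans (by linarith)

lemma integral_positionEntropy_nonneg [IsProbabilityMeasure μ] (n : ℕ) :
    0 ≤ ∫ e, positionEntropy μ (unerased n e) ∂ν :=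
  integral_nonneg fun _ => positionEntropy_nonneg μ _

lemma tendsto_blockRate [IsProbabilityMeasure μ] [IsProbabilityMeasure ν]
    (hμ : MeasurePreserving shift μ μ) (hν : MeasurePreserving shift ν ν) :
    Tendsto (blockRate μ ν) atTop (𝓝 (mutualInfoRate μ ν)) := by
  have hlim := (subadditive_integral_positionEntropy hμ hν).tendsto_lim
    ⟨0, by rintro _ ⟨n, rfl⟩; exact div_nonneg (integral_positionEntropy_nonneg n) n.cast_nonneg⟩
  rw [← funext fun n => blockRate_eq (μ := μ) (ν := ν) n] at hlim
  exact tendsto_nhds_limUnder ⟨_, hlim⟩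

lemma IsErasureProcess.integral_positionEntropy_le [IsProbabilityMeasure μ]
    (hν : IsErasureProcess ν ε) (hK : 1 ≤ K) (n : ℕ) :
    ∫ e, positionEntropy μ (unerased n e) ∂ν ≤ n * ((1 - ε) * Real.log K) := by
  have := hν.prob
  calc ∫ e, positionEntropy μ (unerased n e) ∂ν
      ≤ ∫ e, ((unerased n e).card : ℝ) * Real.log K ∂ν :=
        integral_mono (integrable_comp_unerased ν n _)
          (integrable_comp_unerased ν n fun A => (A.card : ℝ) * Real.log K)
          fun e => positionEntropy_le μ hK _
    _ = n * ((1 - ε) * Real.log K) := by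
        simp_rw [card_unerased]
        rw [integral_mul_const, integral_finsetSum _ fun k _ => integrable_indicator_one ν _]
        simp_rw [hν.integral_indicator]
        rw [Finset.sum_const, Finset.card_range, nsmul_eq_mul, mul_assoc]

/-- Each position is unerased with probability 1 - ε, so the averaged increments telescope. -/
lemma IsErasureProcess.le_integral_positionEntropy [IsProbabilityMeasure μ]
    (hν : IsErasureProcess ν ε) (n : ℕ) :
    (1 - ε) * positionEntropy μ (Finset.range n) ≤
      ∫ e, positionEntropy μ (unerased n e) ∂ν := by
  have := hν.prob
  have hintegrable : ∀ k ∈ Finset.range n, Integrable (fun e : ℤ → Fin 2 =>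
      (if e (k + 1) = 1 then (1 : ℝ) else 0) *
        (positionEntropy μ (Finset.range (k + 1)) - positionEntropy μ (Finset.range k))) ν :=
    fun k _ => (integrable_indicator_one ν _).mul_const _
  refine le_of_eq_of_le ?_ (integral_mono (integrable_finsetSum _ hintegrable)
    (integrable_comp_unerased ν n _) (sum_increments_le_positionEntropy μ n))
  rw [integral_finsetSum _ hintegrable]
  simp_rw [integral_mul_const, hν.integral_indicator]
  rw [← Finset.mul_sum, Finset.sum_range_sub fun k => positionEntropy μ (Finset.range k),
    Finset.range_zero, positionEntropy_empty, sub_zero]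

lemma integral_positionEntropy_le_range [IsProbabilityMeasure μ] [IsProbabilityMeasure ν]
    (n : ℕ) : ∫ e, positionEntropy μ (unerased n e) ∂ν ≤ positionEntropy μ (Finset.range n) := by
  refine (integral_mono (integrable_comp_unerased ν n _) (integrable_const _) fun e =>
    positionEntropy_mono μ (Finset.filter_subset _ _)).trans_eq ?_
  simp

variable {S : Set (List (Input K))}

lemma IsAdmissibleInput.mutualInfoRate_le (hμ : IsAdmissibleInput S μ)
    (hν : IsErasureProcess ν ε) (hK : 1 ≤ K) :
    mutualInfoRate μ ν ≤ (1 - ε) * Real.log K := by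
  have := hμ.prob
  have := hν.prob
  refine le_of_tendsto (tendsto_blockRate hμ.stationary hν.ergodic.toMeasurePreserving) ?_
  filter_upwards [eventually_gt_atTop 0] with n hn
  rw [blockRate_eq, div_le_iff₀ (by exact_mod_cast hn), mul_comm]
  exact hν.integral_positionEntropy_le hK n

/-- The entropy of the full block separates the two sides, so the comparison process may have any
erasure rate ε'. -/
lemma IsAdmissibleInput.mul_mutualInfoRate_le (hμ : IsAdmissibleInput S μ)
    (hν : IsErasureProcess ν ε) {ν' : Measure (ℤ → Fin 2)} {ε' : ℝ}
    (hν' : IsErasureProcess ν' ε') (hε : ε ≤ 1) :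
    (1 - ε) * mutualInfoRate μ ν' ≤ mutualInfoRate μ ν := by
  have := hμ.prob
  have := hν.prob
  have := hν'.prob
  refine le_of_tendsto_of_tendsto'
    ((tendsto_blockRate hμ.stationary hν'.ergodic.toMeasurePreserving).const_mul (1 - ε))
    (tendsto_blockRate hμ.stationary hν.ergodic.toMeasurePreserving) fun n => ?_
  rw [blockRate_eq, blockRate_eq, ← mul_div_assoc]
  gcongr
  exact (mul_le_mul_of_nonneg_left (integral_positionEntropy_le_range n) (sub_nonneg.2 hε)).trans
    (hν.le_integral_positionEntropy n)

lemma IsErasureProcess.capacityWellDefined (hν : IsErasureProcess ν ε) (hK : 1 ≤ K)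
    (hne : ∃ μ, IsAdmissibleInput S μ) : CapacityWellDefined S ν where
  tendsto μ hμ := by
    have := hμ.prob
    have := hν.prob
    exact tendsto_blockRate hμ.stationary hν.ergodic.toMeasurePreserving
  nonempty := hne.imp' (fun μ => mutualInfoRate μ ν) fun μ hμ => ⟨μ, hμ, rfl⟩
  bddAbove := ⟨(1 - ε) * Real.log K, by
    rintro _ ⟨μ, hμ, rfl⟩
    exact hμ.mutualInfoRate_le hν hK⟩

end Bounds

end ErasureChannel

end

/-! ### Passage to the suprema over inputs -/

theorem mainTheorem8 (K : ℕ) (S : Set (List (ErasureChannel.Input K)))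
    (hS : ErasureChannel.IsFiniteType S) (hirr : ErasureChannel.IsIrreducibleConstraint S)
    (hne : ∃ w ∈ S, w ≠ [])
    (ε : ℝ) (ν ν₀ : MeasureTheory.Measure (ℤ → Fin 2))
    (hν : ErasureChannel.IsErasureProcess ν ε)
    (hν₀ : ErasureChannel.IsErasureProcess ν₀ 0) :
    ErasureChannel.CapacityWellDefined S ν ∧
    ErasureChannel.CapacityWellDefined S ν₀ ∧
    (1 - ε) * ErasureChannel.capacity S ν₀ ≤ ErasureChannel.capacity S ν ∧
    ErasureChannel.capacity S ν ≤ (1 - ε) * Real.log K := by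
  -- A non-empty word supplies a letter, so the alphabet is non-empty.
  have hK : 1 ≤ K := by
    obtain ⟨w, -, hw⟩ := hne
    obtain ⟨a, -⟩ := List.exists_mem_of_ne_nil w hw
    have := Finset.mem_Icc.1 a.2
    omega
  have hadm := ErasureChannel.exists_isAdmissibleInput hS hirr hne
  have hW := hν.capacityWellDefined hK hadm
  have hW₀ := hν₀.capacityWellDefined hK hadm
  have hε : ε ≤ 1 := by
    have := hν.prob
    rw [← hν.rate]
    exact measureReal_le_one
  refine ⟨hW, hW₀, ?_, csSup_le hW.nonempty ?_⟩
  · rw [ErasureChannel.capacity, ← smul_eq_mul, ← Real.sSup_smul_of_nonneg (sub_nonneg.2 hε)]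
    refine csSup_le hW₀.nonempty.smul_set ?_
    rintro _ ⟨_, ⟨μ, hμ, rfl⟩, rfl⟩
    exact (hμ.mul_mutualInfoRate_le hν hν₀ hε).trans (le_csSup hW.bddAbove ⟨μ, hμ, rfl⟩)
  · rintro _ ⟨μ, hμ, rfl⟩
    exact hμ.mutualInfoRate_le hν hK
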